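/- Let $1\le p\le\infty$, let $m\ge 2$ be an integer, and let $C_1,C_2>0$. Then there is an open (that is, non-compact and geodesically complete) $m$-dimensional Riemannian manifold $(\mathcal M,g)$ and a smooth compactly supported function $f:\mathcal M\to\mathbb R$ such that $$\|\nabla\nabla f\|_{L^p}^p> C_1\|\Delta f\|_{L^p}^p+C_2\|f\|_{L^p}^p ,$$ where for $p=\infty$ the inequality is read without the exponents, as $\|\nabla\nabla f\|_{L^\infty}> C_1\|\Delta f\|_{L^\infty}+C_2\|f\|_{L^\infty}$. Here $\nabla\nabla f$ is the Hessian of $f$ with respect to the Levi-Civita connection of $g$, $\Delta f$ is its trace with respect to $g$ (the Laplace–Beltrami operator), and the $L^p$-norms of tensor fields are taken with respect to $g$ and its Riemannian volume measure. Moreover, one can take $\mathcal M=\mathbb R^m$ with a smooth rotationally symmetric warped-product metric $g=dr^2+\sigma(r)^2\,\mathbf{can}^{m-1}$ on $\mathbb R^m\setminus\{0\}$, where $r=|x|$, $\mathbf{can}^{m-1}$ is the round metric of the unit sphere $S^{m-1}$, and $\sigma$ is smooth with $\sigma(0)=0$ and $\sigma(r)>0$ for $r>0$. -/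

import Mathlib

open MeasureTheory Bundle
open scoped Manifold ContDiff ENNReal InnerProductSpace

noncomputable section

namespace CZ

/-- `ℝ^m` with its Euclidean structure; its standard coordinates are a global chart. -/
abbrev E (m : ℕ) : Type := EuclideanSpace ℝ (Fin m)

/-- Smooth Riemannian metrics on the manifold `ℝ^m`. -/
abbrev Metric (m : ℕ) : Type :=
  ContMDiffRiemannianMetric 𝓘(ℝ, E m) ∞ (E m) (fun x : E m => TangentSpace 𝓘(ℝ, E m) x)

variable {m : ℕ}

/-- The inner product `g_x(v, w)`, the tangent space at `x` being `ℝ^m`. -/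
def Metric.form (g : Metric m) (x v w : E m) : ℝ :=
  g.inner x (v : TangentSpace 𝓘(ℝ, E m) x) (w : TangentSpace 𝓘(ℝ, E m) x)

/-- The `i`-th coordinate partial derivative. -/
def partialDeriv (i : Fin m) (F : E m → ℝ) (x : E m) : ℝ :=
  fderiv ℝ F x (EuclideanSpace.single i 1)

/-- The matrix `(g_{ij}(x))`. -/
def Metric.gram (g : Metric m) (x : E m) : Matrix (Fin m) (Fin m) ℝ :=
  Matrix.of fun i j => g.form x (EuclideanSpace.single i 1) (EuclideanSpace.single j 1)

/-- The inverse matrix `(g^{ij}(x))`. -/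
def Metric.cogram (g : Metric m) (x : E m) : Matrix (Fin m) (Fin m) ℝ := (g.gram x)⁻¹

/-- Christoffel symbols `Γ^k_{ij}` of the Levi-Civita connection. -/
def Metric.christoffel (g : Metric m) (k i j : Fin m) (x : E m) : ℝ :=
  (1 / 2) * ∑ l, g.cogram x k l *
    (partialDeriv i (fun y => g.gram y j l) x + partialDeriv j (fun y => g.gram y i l) x
      - partialDeriv l (fun y => g.gram y i j) x)

/-- Geodesics defined on all of `ℝ`. -/
def Metric.IsGeodesic (g : Metric m) (γ : ℝ → E m) : Prop :=
  ContDiff ℝ 2 γ ∧ ∀ (t : ℝ) (k : Fin m),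
    deriv (deriv γ) t k
      + ∑ i, ∑ j, g.christoffel k i j (γ t) * deriv γ t i * deriv γ t j = 0

/-- Every initial position and velocity is that of a geodesic defined for all times. -/
def Metric.GeodesicallyComplete (g : Metric m) : Prop :=
  ∀ x v : E m, ∃ γ : ℝ → E m, g.IsGeodesic γ ∧ γ 0 = x ∧ deriv γ 0 = v

/-- The Riemannian manifold `(ℝ^m, g)` is open: non-compact and geodesically complete. -/
def Metric.IsOpenManifold (g : Metric m) : Prop :=
  NoncompactSpace (E m) ∧ g.GeodesicallyComplete

/-- Components `∂_i ∂_j f - Γ^k_{ij} ∂_k f` of the Hessian `∇∇f`. -/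
def Metric.hessian (g : Metric m) (f : E m → ℝ) (x : E m) : Matrix (Fin m) (Fin m) ℝ :=
  Matrix.of fun i j =>
    partialDeriv i (partialDeriv j f) x - ∑ k, g.christoffel k i j x * partialDeriv k f x

/-- The pointwise norm `|∇∇f|_g` of the Hessian as a 2-tensor. -/
def Metric.hessianNorm (g : Metric m) (f : E m → ℝ) (x : E m) : ℝ :=
  Real.sqrt (∑ i, ∑ j, ∑ a, ∑ b,
    g.cogram x i a * g.cogram x j b * g.hessian f x i j * g.hessian f x a b)

/-- The Laplace–Beltrami operator: the metric trace of the Hessian. -/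
def Metric.laplacian (g : Metric m) (f : E m → ℝ) (x : E m) : ℝ :=
  ∑ i, ∑ j, g.cogram x i j * g.hessian f x i j

/-- The Riemannian volume measure `√(det g) dx`. -/
def Metric.vol (g : Metric m) : Measure (E m) :=
  volume.withDensity fun x => ENNReal.ofReal (Real.sqrt (g.gram x).det)

/-- `‖F‖_{L^p}^p` with respect to the volume of `g`; for `p = ∞` this is `‖F‖_{L^∞}`. -/
def Metric.lpPow (g : Metric m) (p : ℝ≥0∞) (F : E m → ℝ) : ℝ≥0∞ :=
  if p = ⊤ then eLpNorm F ⊤ g.vol else eLpNorm F p g.vol ^ p.toReal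

/-- The metric is `dr² + σ(r)² can^{m-1}` away from the origin, where `r = |x|` and `can^{m-1}` is
the round metric of the unit sphere pulled back along `x ↦ x / |x|`. -/
def Metric.IsWarpedProduct (g : Metric m) (σ : ℝ → ℝ) : Prop :=
  ∀ x : E m, x ≠ 0 → ∀ v w : E m,
    g.form x v w = (⟪x, v⟫_ℝ / ‖x‖) * (⟪x, w⟫_ℝ / ‖x‖)
      + σ ‖x‖ ^ 2 * (⟪v, w⟫_ℝ / ‖x‖ ^ 2 - ⟪x, v⟫_ℝ * ⟪x, w⟫_ℝ / ‖x‖ ^ 4)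

end CZ

end

/-! The metric and the function are both radial and oscillate with a large frequency `N`. Put `s =
|x|²` and `σ(r) = r exp(w(r²))`, with `w = wave N θ` supported in `1 ≤ s ≤ 4` and `0 ≤ w ≤ 2` for
every `N`, while `w'` has size `N`. For `f = φ(s)` the Hessian has a radial eigenvalue, and the
eigenvalue `2φ'(1 + 2s w')` with multiplicity `m - 1` in the spherical directions. Hence the
Laplacian is `2φ' + 4sφ'' + (m - 1) · 2φ'(1 + 2s w')`.

Choose `φ' = χ exp(-(m - 1) w)` with a fixed cutoff `χ`. The derivative of the exponential in
`4sφ''` cancels the `w'` of the spherical part exactly, so the Laplacian contains no `w'`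
(`laplacian_potential`). It, `f` and the volumes are then bounded independently of `N` and `θ`. The
spherical eigenvalue still contains `w'`, so the Hessian has size at least a constant times `N`
wherever the cosine in `w'` is not small (`le_hessianNorm_potential`). For one of two phases this
happens on at least half of a fixed shell (`exists_half_volume_shell_le`), so a large `N` defeats
any `C₁, C₂`, for all `p` by the same construction.

Completeness holds because the metric is Euclidean for `|x| ≥ 2` and dominates the Euclidean one
everywhere: conservation of energy bounds the velocity, and the Christoffel symbols have compact
support. -/

open scoped NNReal

/-! ### Global flows of bounded Lipschitz fields -/

/-- A bounded globally Lipschitz vector field on a Banach space is complete. -/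
theorem exists_hasDerivAt_of_lipschitzWith_of_bounded {F : Type*} [NormedAddCommGroup F]
    [NormedSpace ℝ F] [CompleteSpace F] {V : F → F} {K L : ℝ≥0} (hK : LipschitzWith K V)
    (hL : ∀ x, ‖V x‖ ≤ L) (x₀ : F) :
    ∃ α : ℝ → F, α 0 = x₀ ∧ ∀ t, HasDerivAt α (V (α t)) t := by
  have hloc : ∀ n : ℕ, ∃ α : ℝ → F, α 0 = x₀ ∧
      ∀ t ∈ Set.Ioo (-(n + 1 : ℝ)) (n + 1), HasDerivAt α (V (α t)) t := by
    intro n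
    have h0 : (0 : ℝ) ∈ Set.Icc (-(n + 1 : ℝ)) (n + 1) := ⟨by linarith, by positivity⟩
    -- At speed at most `L`, a curve stays within `L * (n + 1)` of its start up to time `n + 1`, so
    -- Picard–Lindelöf applies on the whole interval.
    have hPL : IsPicardLindelof (fun _ ↦ V) (⟨0, h0⟩ : Set.Icc (-(n + 1 : ℝ)) (n + 1)) x₀
        (L * (n + 1)) 0 L K :=
      IsPicardLindelof.of_time_independent (fun x _ ↦ hL x) hK.lipschitzOnWith (by simp)
    obtain ⟨α, hα0, hα⟩ := hPL.exists_eq_forall_mem_Icc_hasDerivWithinAt₀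
    exact ⟨α, hα0, fun t ht ↦ (hα t (Set.Ioo_subset_Icc_self ht)).hasDerivAt
      (Icc_mem_nhds ht.1 ht.2)⟩
  choose α hα0 hα using hloc
  have huniq : ∀ {n k : ℕ}, n ≤ k → Set.EqOn (α n) (α k) (Set.Ioo (-(n + 1 : ℝ)) (n + 1)) := by
    intro n k hnk
    have hnk' : (n : ℝ) ≤ k := by exact_mod_cast hnk
    refine ODE_solution_unique_of_mem_Ioo (v := fun _ ↦ V) (s := fun _ ↦ Set.univ) (K := K)
      (t₀ := 0) (fun _ _ ↦ hK.lipschitzOnWith) ⟨by linarith, by positivity⟩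
      (fun t ht ↦ ⟨hα n t ht, Set.mem_univ _⟩)
      (fun t ht ↦ ⟨hα k t ⟨by linarith [ht.1], by linarith [ht.2]⟩, Set.mem_univ _⟩)
      ((hα0 n).trans (hα0 k).symm)
  -- The index `⌊|t|⌋₊` jumps with `t`, but by uniqueness the glued curve agrees with a single `α n`
  -- on an open interval, which is enough to differentiate it.
  have hglue : ∀ (n : ℕ), Set.EqOn (fun t ↦ α ⌊|t|⌋₊ t) (α n) (Set.Ioo (-(n + 1 : ℝ)) (n + 1)) := by
    intro n t ht
    have hfl : ⌊|t|⌋₊ ≤ n := by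
      have h := abs_lt.2 ht
      rw [← Nat.lt_succ_iff, Nat.floor_lt (abs_nonneg t)]
      exact_mod_cast h
    exact huniq hfl (abs_lt.1 (Nat.lt_floor_add_one |t|))
  refine ⟨fun t ↦ α ⌊|t|⌋₊ t, by simpa using hα0 0, fun t ↦ ?_⟩
  have ht : t ∈ Set.Ioo (-(⌊|t|⌋₊ + 1 : ℝ)) (⌊|t|⌋₊ + 1) := abs_lt.1 (Nat.lt_floor_add_one |t|)
  exact (hα ⌊|t|⌋₊ t ht).congr_of_eventuallyEq
    (Filter.eventuallyEq_of_mem (Ioo_mem_nhds ht.1 ht.2) (hglue _))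

/-! ### Geodesic flow and completeness -/

namespace CZ

variable {m : ℕ}

theorem partialDeriv_sum_mul (F : E m → ℝ) (x v : E m) :
    fderiv ℝ F x v = ∑ i, partialDeriv i F x * v i := by
  conv_lhs => rw [← (EuclideanSpace.basisFun (Fin m) ℝ).sum_repr v]
  simp [partialDeriv, mul_comm]

theorem contDiff_partialDeriv {F : E m → ℝ} (hF : ContDiff ℝ ∞ F) (i : Fin m) :
    ContDiff ℝ ∞ (partialDeriv i F) :=
  (hF.fderiv_right (m := ∞) (by simp)).clm_apply contDiff_const

namespace Metric

variable (g : Metric m)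

theorem form_eq_sum (x v w : E m) : g.form x v w = ∑ i, ∑ j, g.gram x i j * v i * w j := by
  let B : E m →L[ℝ] E m →L[ℝ] ℝ := g.inner x
  change B v w = ∑ i, ∑ j, B (EuclideanSpace.single i 1) (EuclideanSpace.single j 1) * v i * w j
  conv_lhs => rw [← (EuclideanSpace.basisFun (Fin m) ℝ).sum_repr v,
    ← (EuclideanSpace.basisFun (Fin m) ℝ).sum_repr w]
  simp only [map_sum, map_smul, sum_apply, smul_apply,
    EuclideanSpace.basisFun_apply, EuclideanSpace.basisFun_repr, smul_eq_mul]
  rw [Finset.sum_comm]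
  simp only [Finset.mul_sum]
  refine Finset.sum_congr rfl fun i _ ↦ Finset.sum_congr rfl fun j _ ↦ by ring

theorem gram_comm (x : E m) (i j : Fin m) : g.gram x i j = g.gram x j i :=
  g.symm x _ _

/-- Lowering the upper index of the Christoffel symbols. -/
theorem sum_gram_mul_christoffel {x : E m} (hdet : IsUnit (g.gram x).det) (l i j : Fin m) :
    ∑ k, g.gram x l k * g.christoffel k i j x =
      (1 / 2) * (partialDeriv i (fun y => g.gram y j l) x + partialDeriv j (fun y => g.gram y i l) x
        - partialDeriv l (fun y => g.gram y i j) x) := by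
  set T : Fin m → ℝ := fun l ↦ partialDeriv i (fun y => g.gram y j l) x
    + partialDeriv j (fun y => g.gram y i l) x - partialDeriv l (fun y => g.gram y i j) x with hT
  have h1 : (fun k ↦ g.christoffel k i j x) = (1 / 2 : ℝ) • (g.cogram x).mulVec T := by
    ext k; rfl
  calc ∑ k, g.gram x l k * g.christoffel k i j x
      = (g.gram x).mulVec (fun k ↦ g.christoffel k i j x) l := rfl
    _ = (1 / 2) * T l := by
      rw [h1, Matrix.mulVec_smul, Matrix.mulVec_mulVec, cogram, Matrix.mul_nonsing_inv _ hdet,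
        Matrix.one_mulVec]
      rfl

/-- The acceleration `-Γ(v, v)` of the geodesic with position `x` and velocity `v`. -/
noncomputable def geodesicAcceleration (x v : E m) : E m :=
  WithLp.toLp 2 fun k ↦ -∑ i, ∑ j, g.christoffel k i j x * v i * v j

/-- The derivative of `g(v, v)` along a curve whose velocity and acceleration are proportional,
by the same factor, to those of the geodesic flow vanishes. -/
theorem hasDerivAt_form_of_geodesicFlow {g : Metric m} (hdet : ∀ x, IsUnit (g.gram x).det)
    (hdiff : ∀ i j, Differentiable ℝ fun x ↦ g.gram x i j) {x v : ℝ → E m} {t c : ℝ}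
    (hx : HasDerivAt x (c • v t) t)
    (hv : HasDerivAt v (c • g.geodesicAcceleration (x t) (v t)) t) :
    HasDerivAt (fun t ↦ g.form (x t) (v t) (v t)) 0 t := by
  have hvi : ∀ i, HasDerivAt (fun t ↦ v t i)
      (c * -∑ a, ∑ b, g.christoffel i a b (x t) * v t a * v t b) t := fun i ↦
    (EuclideanSpace.proj (𝕜 := ℝ) i : E m →L[ℝ] ℝ).hasFDerivAt.comp_hasDerivAt t hv
  have hG : ∀ i j, HasDerivAt (fun t ↦ g.gram (x t) i j)
      (∑ k, partialDeriv k (fun y ↦ g.gram y i j) (x t) * (c * v t k)) t := by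
    intro i j
    have := ((hdiff i j) (x t)).hasFDerivAt.comp_hasDerivAt t hx
    rw [partialDeriv_sum_mul] at this
    exact this
  simp_rw [form_eq_sum]
  have hsum := HasDerivAt.fun_sum (u := Finset.univ) fun i _ ↦ HasDerivAt.fun_sum
    (u := Finset.univ) fun j _ ↦ ((hG i j).fun_mul (hvi i)).fun_mul (hvi j)
  refine hsum.congr_deriv ?_
  set w := v t
  set y := x t
  set D : Fin m → Fin m → Fin m → ℝ := fun k i j ↦ partialDeriv k (fun y ↦ g.gram y i j) y with hD
  set S : ℝ := ∑ i, ∑ j, ∑ k, D k i j * w k * w i * w j with hS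
  set Q : ℝ := ∑ j, ∑ a, ∑ b, (∑ k, g.gram y j k * g.christoffel k a b y) * w a * w b * w j with hQ
  -- Contracted with `w` three times, each of the three derivative terms in the lowered Christoffel
  -- symbol becomes `S`, so the total is `S + S - S`.
  have hQS : 2 * Q = S := by
    have h1 : ∑ j, ∑ a, ∑ b, D a b j * w a * w b * w j = S :=
      (Finset.sum_congr rfl fun j _ ↦ Finset.sum_comm).trans Finset.sum_comm
    have h2 : ∑ j, ∑ a, ∑ b, D b a j * w a * w b * w j = S := by
      rw [hS, Finset.sum_comm]
      refine Finset.sum_congr rfl fun j _ ↦ Finset.sum_congr rfl fun a _ ↦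
        Finset.sum_congr rfl fun b _ ↦ by ring
    have h3 : ∑ j, ∑ a, ∑ b, D j a b * w a * w b * w j = S := by
      refine Finset.sum_comm.trans ?_
      refine Finset.sum_congr rfl fun j _ ↦ ?_
      rw [Finset.sum_comm]
      refine Finset.sum_congr rfl fun a _ ↦ Finset.sum_congr rfl fun b _ ↦ by ring
    have h4 : 2 * Q = S + S - S := by
      rw [hQ]
      nth_rewrite 1 [← h1]
      nth_rewrite 1 [← h2]
      rw [← h3]
      simp only [Finset.mul_sum, ← Finset.sum_add_distrib, ← Finset.sum_sub_distrib]
      refine Finset.sum_congr rfl fun j _ ↦ Finset.sum_congr rfl fun a _ ↦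
        Finset.sum_congr rfl fun b _ ↦ ?_
      rw [g.sum_gram_mul_christoffel (hdet y)]
      ring
    linarith
  set A : Fin m → ℝ := fun i ↦ ∑ a, ∑ b, g.christoffel i a b y * w a * w b with hA
  have hGA : ∀ l, ∑ k, g.gram y l k * A k
      = ∑ a, ∑ b, (∑ k, g.gram y l k * g.christoffel k a b y) * w a * w b := by
    intro l
    simp only [hA, Finset.mul_sum, Finset.sum_mul]
    rw [Finset.sum_comm]
    refine Finset.sum_congr rfl fun a _ ↦ ?_
    rw [Finset.sum_comm]
    refine Finset.sum_congr rfl fun b _ ↦ Finset.sum_congr rfl fun k _ ↦ by ring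
  have hQ2 : ∑ i, ∑ j, g.gram y i j * w i * A j = Q := by
    rw [hQ]
    refine Finset.sum_congr rfl fun l _ ↦ ?_
    simp only [← Finset.sum_mul]
    rw [← hGA l, Finset.sum_mul]
    refine Finset.sum_congr rfl fun k _ ↦ by ring
  have hQ1 : ∑ i, ∑ j, g.gram y i j * A i * w j = Q := by
    rw [← hQ2, Finset.sum_comm]
    refine Finset.sum_congr rfl fun i _ ↦ Finset.sum_congr rfl fun j _ ↦ ?_
    rw [g.gram_comm y j i]
    ring
  have hS' : ∑ i, ∑ j, (∑ k, D k i j * (c * w k)) * w i * w j = c * S := by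
    simp only [hS, Finset.mul_sum, Finset.sum_mul]
    refine Finset.sum_congr rfl fun i _ ↦ Finset.sum_congr rfl fun j _ ↦
      Finset.sum_congr rfl fun k _ ↦ by ring
  calc _ = ∑ i, ∑ j, ((∑ k, D k i j * (c * w k)) * w i * w j
        - c * (g.gram y i j * A i * w j) - c * (g.gram y i j * w i * A j)) :=
        Finset.sum_congr rfl fun i _ ↦ Finset.sum_congr rfl fun j _ ↦ by
          change ((∑ k, D k i j * (c * w k)) * w i + g.gram y i j * (c * -A i)) * w j
            + g.gram y i j * w i * (c * -A j) = _
          ring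
    _ = 0 := by
      simp only [Finset.sum_sub_distrib, ← Finset.mul_sum]
      rw [hS', hQ1, hQ2]
      linear_combination (-c) * hQS

/-- A metric that dominates the Euclidean one and whose Christoffel symbols are smooth with
compact support is geodesically complete. -/
theorem geodesicallyComplete_of_hasCompactSupport {g : Metric m}
    (hdet : ∀ x, IsUnit (g.gram x).det)
    (hdiff : ∀ i j, Differentiable ℝ fun x ↦ g.gram x i j)
    (hΓ : ∀ k i j, ContDiff ℝ ∞ (g.christoffel k i j))
    (hsupp : ∀ k i j, HasCompactSupport (g.christoffel k i j))
    (hle : ∀ x v, ‖v‖ ^ 2 ≤ g.form x v v) : g.GeodesicallyComplete := by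
  intro x₀ v₀
  have hR : 0 < Real.sqrt (g.form x₀ v₀ v₀) + 1 := by positivity
  -- The velocity is truncated only beyond the largest norm that the initial energy allows; the `+
  -- 1` keeps the inner radius positive.
  let φ : ContDiffBump (0 : E m) := ⟨Real.sqrt (g.form x₀ v₀ v₀) + 1,
    Real.sqrt (g.form x₀ v₀ v₀) + 2, hR, by linarith⟩
  have hφ : ContDiff ℝ ∞ φ := φ.contDiff
  have hacc : ContDiff ℝ ∞ fun z : E m × E m ↦ g.geodesicAcceleration z.1 z.2 := by
    unfold geodesicAcceleration
    refine (PiLp.contDiff_toLp (p := 2)).comp (contDiff_pi.2 fun k ↦ ?_)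
    refine ContDiff.neg (ContDiff.sum fun i _ ↦ ContDiff.sum fun j _ ↦ ?_)
    have := hΓ k i j
    fun_prop
  let V₁ : E m → E m := fun v ↦ φ v • v
  let V₂ : E m × E m → E m := fun z ↦ φ z.2 • g.geodesicAcceleration z.1 z.2
  have hV₁ : ContDiff ℝ ∞ V₁ := hφ.smul contDiff_id
  have hV₂ : ContDiff ℝ ∞ V₂ := (hφ.comp contDiff_snd).smul hacc
  have hc₁ : HasCompactSupport V₁ := φ.hasCompactSupport.smul_right
  -- The Christoffel symbols confine the position and the bump confines the velocity.
  have hc₂ : HasCompactSupport V₂ := by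
    let K : Set (E m) := ⋃ k, ⋃ i, ⋃ j, tsupport (g.christoffel k i j)
    have hK : IsCompact K := isCompact_iUnion fun k ↦ isCompact_iUnion fun i ↦
      isCompact_iUnion fun j ↦ hsupp k i j
    refine HasCompactSupport.intro (hK.prod φ.hasCompactSupport) fun z hz ↦ ?_
    by_cases h1 : z.1 ∈ K
    · have h2 : z.2 ∉ tsupport φ := fun h ↦ hz ⟨h1, h⟩
      simp [V₂, image_eq_zero_of_notMem_tsupport h2]
    · have h3 : ∀ k i j, g.christoffel k i j z.1 = 0 := fun k i j ↦ by
        refine image_eq_zero_of_notMem_tsupport fun h ↦ h1 ?_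
        simp only [K, Set.mem_iUnion]
        exact ⟨k, i, j, h⟩
      have h4 : g.geodesicAcceleration z.1 z.2 = 0 := by
        ext k
        simp [geodesicAcceleration, h3]
      simp [V₂, h4]
  obtain ⟨K₁, hK₁⟩ := hV₁.lipschitzWith_of_hasCompactSupport hc₁ (by simp)
  obtain ⟨K₂, hK₂⟩ := hV₂.lipschitzWith_of_hasCompactSupport hc₂ (by simp)
  obtain ⟨B₁, hB₁⟩ := hV₁.continuous.bounded_above_of_compact_support hc₁
  obtain ⟨B₂, hB₂⟩ := hV₂.continuous.bounded_above_of_compact_support hc₂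
  obtain ⟨α, hα0, hα⟩ := exists_hasDerivAt_of_lipschitzWith_of_bounded
    (V := fun z : E m × E m ↦ (V₁ z.2, V₂ z)) (L := Real.toNNReal (max B₁ B₂))
    ((hK₁.comp LipschitzWith.prod_snd).prodMk hK₂)
    (fun z ↦ (max_le_max (hB₁ z.2) (hB₂ z)).trans (Real.le_coe_toNNReal _)) (x₀, v₀)
  have hx : ∀ t, HasDerivAt (fun t ↦ (α t).1) (φ (α t).2 • (α t).2) t := fun t ↦
    (hasFDerivAt_fst (𝕜 := ℝ) (p := α t)).comp_hasDerivAt t (hα t)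
  have hv : ∀ t, HasDerivAt (fun t ↦ (α t).2)
      (φ (α t).2 • g.geodesicAcceleration (α t).1 (α t).2) t := fun t ↦
    (hasFDerivAt_snd (𝕜 := ℝ) (p := α t)).comp_hasDerivAt t (hα t)
  -- The truncation multiplies velocity and acceleration by the same factor, so energy is conserved
  -- along the truncated flow too. The velocity then never leaves the region where `φ = 1`, and the
  -- flow is geodesic.
  have henergy : ∀ t, HasDerivAt (fun t ↦ g.form (α t).1 (α t).2 (α t).2) 0 t := fun t ↦
    hasDerivAt_form_of_geodesicFlow hdet hdiff (hx t) (hv t)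
  have hconst : ∀ t, g.form (α t).1 (α t).2 (α t).2 = g.form x₀ v₀ v₀ := fun t ↦ by
    have := is_const_of_deriv_eq_zero (fun t ↦ (henergy t).differentiableAt)
      (fun t ↦ (henergy t).deriv) t 0
    simpa [hα0] using this
  have hφ1 : ∀ t, φ (α t).2 = 1 := fun t ↦ by
    refine φ.one_of_mem_closedBall ?_
    rw [mem_closedBall_zero_iff]
    have : ‖(α t).2‖ ≤ Real.sqrt (g.form x₀ v₀ v₀) :=
      Real.le_sqrt_of_sq_le ((hle (α t).1 _).trans_eq (hconst t))
    exact this.trans (by simp [φ])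
  simp only [hφ1, one_smul] at hx hv
  have hdx : deriv (fun t ↦ (α t).1) = fun t ↦ (α t).2 := funext fun t ↦ (hx t).deriv
  have hdv : deriv (fun t ↦ (α t).2) = fun t ↦ g.geodesicAcceleration (α t).1 (α t).2 :=
    funext fun t ↦ (hv t).deriv
  have hαc : Continuous α := continuous_iff_continuousAt.2 fun t ↦ (hα t).continuousAt
  refine ⟨fun t ↦ (α t).1, ⟨?_, fun t k ↦ ?_⟩, by simp [hα0], by simp [hdx, hα0]⟩
  · rw [show (2 : WithTop ℕ∞) = 1 + 1 by norm_num, contDiff_succ_iff_deriv]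
    refine ⟨fun t ↦ (hx t).differentiableAt, by simp, ?_⟩
    rw [hdx, contDiff_one_iff_deriv, hdv]
    exact ⟨fun t ↦ (hv t).differentiableAt, hacc.continuous.comp hαc⟩
  · rw [hdx, hdv]
    simp [geodesicAcceleration]

end Metric
-- Radial metrics: smoothness, inverse and determinant
/-- A rotationally symmetric metric `h(|x|²) |v|² + k(|x|²) ⟪x, v⟫²` on `ℝ^m` for which the radial
direction has unit length and which dominates the Euclidean metric. -/
structure RadialProfile where
  /-- The coefficient in directions tangent to spheres. -/
  h : ℝ → ℝ
  /-- The coefficient of the radial correction. -/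
  k : ℝ → ℝ
  contDiff_h : ContDiff ℝ ∞ h
  contDiff_k : ContDiff ℝ ∞ k
  one_le_h : ∀ s, 1 ≤ h s
  h_add : ∀ s, h s + k s * s = 1

namespace RadialProfile

variable (P : RadialProfile)

theorem h_pos (s : ℝ) : 0 < P.h s := one_pos.trans_le (P.one_le_h s)

section InnerProductSpace

variable {F : Type*} [NormedAddCommGroup F] [InnerProductSpace ℝ F]

/-- The bilinear form of the metric at `x`. -/
noncomputable def bilin (x : F) : F →L[ℝ] F →L[ℝ] ℝ :=
  let B : F →L[ℝ] F →L[ℝ] ℝ := innerSL ℝ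
  P.h (‖x‖ ^ 2) • B + P.k (‖x‖ ^ 2) • (B x).smulRight (B x)

theorem bilin_apply (x v w : F) :
    P.bilin x v w = P.h (‖x‖ ^ 2) * ⟪v, w⟫_ℝ + P.k (‖x‖ ^ 2) * (⟪x, v⟫_ℝ * ⟪x, w⟫_ℝ) := by
  simp only [bilin, add_apply, smul_apply, ContinuousLinearMap.smulRight_apply, smul_eq_mul]
  rfl

theorem bilin_comm (x v w : F) : P.bilin x v w = P.bilin x w v := by
  rw [bilin_apply, bilin_apply, real_inner_comm, mul_comm ⟪x, v⟫_ℝ]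

/-- The form has eigenvalue `1` radially and `h ≥ 1` tangentially. For `k < 0` this is
Cauchy–Schwarz combined with `h_add`. -/
theorem sq_norm_le_bilin (x v : F) : ‖v‖ ^ 2 ≤ P.bilin x v v := by
  rw [bilin_apply, real_inner_self_eq_norm_sq]
  have h1 := P.h_add (‖x‖ ^ 2)
  have h2 := P.one_le_h (‖x‖ ^ 2)
  have h3 : ⟪x, v⟫_ℝ * ⟪x, v⟫_ℝ ≤ ‖x‖ ^ 2 * ‖v‖ ^ 2 := by
    have := real_inner_mul_inner_self_le x v
    simpa [real_inner_self_eq_norm_sq] using this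
  rcases le_or_gt 0 (P.k (‖x‖ ^ 2)) with hk | hk
  · have := mul_nonneg hk (mul_self_nonneg ⟪x, v⟫_ℝ)
    nlinarith [sq_nonneg ‖v‖]
  · have := mul_le_mul_of_nonpos_left h3 hk.le
    have e : ‖v‖ ^ 2 = P.h (‖x‖ ^ 2) * ‖v‖ ^ 2 + P.k (‖x‖ ^ 2) * (‖x‖ ^ 2 * ‖v‖ ^ 2) := by
      linear_combination (-‖v‖ ^ 2) * h1
    linarith

theorem bilin_pos (x : F) {v : F} (hv : v ≠ 0) : 0 < P.bilin x v v :=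
  (pow_pos (norm_pos_iff.2 hv) 2).trans_le (P.sq_norm_le_bilin x v)

set_option maxSynthPendingDepth 3 in
theorem contDiff_bilin : ContDiff ℝ ∞ (P.bilin : F → F →L[ℝ] F →L[ℝ] ℝ) := by
  have hn : ContDiff ℝ ∞ fun x : F ↦ ‖x‖ ^ 2 := contDiff_norm_sq ℝ
  let B : F →L[ℝ] F →L[ℝ] ℝ := innerSL ℝ
  have hi : ContDiff ℝ ∞ fun x : F ↦ B x := B.contDiff
  exact ((P.contDiff_h.comp hn).smul contDiff_const).add
    ((P.contDiff_k.comp hn).smul (hi.smulRight hi))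

/-- Covectors on a vector space read in the trivialization at a point. -/
theorem trivializationAt_covector_apply (x y : F) (L : TangentSpace 𝓘(ℝ, F) y →L[ℝ] ℝ) (w : F) :
    (((trivializationAt (F →L[ℝ] ℝ) (fun x : F => TangentSpace 𝓘(ℝ, F) x →L[ℝ] ℝ)
      x).continuousLinearMapAt ℝ y) L) w
    = L ((trivializationAt F (TangentSpace 𝓘(ℝ, F)) x).symmL ℝ y w) := by
  rw [Trivialization.continuousLinearMapAt_apply, Trivialization.linearMapAt_apply, if_pos]
  · rw [hom_trivializationAt_apply]
    change ((trivializationAt ℝ (fun x : F => ℝ) x).continuousLinearMapAt ℝ y)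
      (L ((trivializationAt F (TangentSpace 𝓘(ℝ, F)) x).symmL ℝ y w)) = _
    rw [Trivialization.continuousLinearMapAt_apply, Trivialization.linearMapAt_apply, if_pos]
    · rfl
    · trivial
  · simp [chartAt_self_eq]

variable (F) in
/-- The Riemannian metric with the given profile on an inner product space. -/
noncomputable def riemannianMetric : ContMDiffRiemannianMetric 𝓘(ℝ, F) ∞ F
    (fun x : F => TangentSpace 𝓘(ℝ, F) x) where
  inner x := (P.bilin x : F →L[ℝ] F →L[ℝ] ℝ)
  symm x := P.bilin_comm (F := F) x
  pos x _ hv := P.bilin_pos (F := F) x hv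
  isVonNBounded x := by
    change Bornology.IsVonNBounded ℝ {v : F | P.bilin x v v < 1}
    refine (NormedSpace.isVonNBounded_ball ℝ F 1).subset fun v hv ↦ ?_
    have h1 : ‖v‖ ^ 2 < 1 := (P.sq_norm_le_bilin x v).trans_lt hv
    rw [mem_ball_zero_iff]
    nlinarith [norm_nonneg v]
  contMDiff := by
    intro x
    refine (contMDiffAt_section x).2 ?_
    refine ((P.contDiff_bilin (F := F)).contMDiff.contMDiffAt (x := x)).congr_of_eventuallyEq
      (Filter.Eventually.of_forall fun y ↦ ?_)
    refine ContinuousLinearMap.ext fun v ↦ ContinuousLinearMap.ext fun w ↦ ?_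
    -- Trivializations of the tangent bundle of a vector space are the identity, so smoothness of
    -- the section reduces to `contDiff_bilin`.
    have hsymm := TangentBundle.symmL_model_space (𝕜 := ℝ) x y
    refine (trivializationAt_covector_apply x y
      (P.bilin y ((trivializationAt F (TangentSpace 𝓘(ℝ, F)) x).symmL ℝ y v)) w).trans ?_
    exact congrArg₂ (fun a b : F ↦ P.bilin y a b) (DFunLike.congr_fun hsymm v)
      (DFunLike.congr_fun hsymm w)

end InnerProductSpace

/-- The Riemannian metric with the given profile on `ℝ^m`. -/
noncomputable def metric (m : ℕ) : Metric m := P.riemannianMetric (E m)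

theorem form_metric (x v w : E m) : (P.metric m).form x v w = P.bilin x v w := rfl

theorem gram_metric (x : E m) (i j : Fin m) : (P.metric m).gram x i j
    = P.h (‖x‖ ^ 2) * (1 : Matrix (Fin m) (Fin m) ℝ) i j + P.k (‖x‖ ^ 2) * (x i * x j) := by
  change P.bilin x _ _ = _
  rw [bilin_apply]
  simp [EuclideanSpace.inner_single_right, Matrix.one_apply, eq_comm]

theorem sum_sq (x : E m) : ∑ i, x i * x i = ‖x‖ ^ 2 := by
  rw [EuclideanSpace.real_norm_sq_eq]
  simp [sq]

theorem gram_metric_eq (x : E m) : (P.metric m).gram x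
    = P.h (‖x‖ ^ 2) • 1 + P.k (‖x‖ ^ 2) • Matrix.vecMulVec (x : Fin m → ℝ) x := by
  ext i j
  rw [gram_metric]
  simp [Matrix.vecMulVec_apply]

theorem vecMulVec_self_mul_self (x : E m) :
    Matrix.vecMulVec (x : Fin m → ℝ) x * Matrix.vecMulVec (x : Fin m → ℝ) x
      = ‖x‖ ^ 2 • Matrix.vecMulVec (x : Fin m → ℝ) x := by
  ext i j
  simp only [Matrix.mul_apply, Matrix.vecMulVec_apply, Matrix.smul_apply, smul_eq_mul,
    ← sum_sq x, Finset.sum_mul]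
  exact Finset.sum_congr rfl fun l _ ↦ by ring

/-- A rank-one perturbation of a scalar matrix has an inverse of the same shape; `h_add` simplifies
its coefficients. -/
theorem gram_mul (x : E m) : (P.metric m).gram x *
    ((P.h (‖x‖ ^ 2))⁻¹ • (1 : Matrix (Fin m) (Fin m) ℝ)
      - (P.k (‖x‖ ^ 2) / P.h (‖x‖ ^ 2)) • Matrix.vecMulVec (x : Fin m → ℝ) x) = 1 := by
  have h0 := (P.h_pos (‖x‖ ^ 2)).ne'
  have h1 := P.h_add (‖x‖ ^ 2)
  rw [gram_metric_eq]
  generalize P.h (‖x‖ ^ 2) = a at *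
  generalize P.k (‖x‖ ^ 2) = b at *
  have e := vecMulVec_self_mul_self x
  generalize Matrix.vecMulVec (x : Fin m → ℝ) x = X at *
  simp only [add_mul, mul_sub, smul_mul_assoc, mul_smul_comm, one_mul, mul_one, e, smul_smul,
    smul_add]
  rw [inv_mul_cancel₀ h0, one_smul]
  have h2 : a⁻¹ * b = b / a * a + b / a * (b * ‖x‖ ^ 2) := by
    field_simp
    linear_combination (-b) * h1
  rw [h2, ← add_smul, add_sub_cancel_right]
  
theorem isUnit_det_gram (x : E m) : IsUnit ((P.metric m).gram x).det :=
  (Matrix.isUnit_iff_isUnit_det _).1 (IsUnit.of_mul_eq_one _ (P.gram_mul x))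

theorem cogram_metric_eq (x : E m) : (P.metric m).cogram x
    = (P.h (‖x‖ ^ 2))⁻¹ • (1 : Matrix (Fin m) (Fin m) ℝ)
      - (P.k (‖x‖ ^ 2) / P.h (‖x‖ ^ 2)) • Matrix.vecMulVec (x : Fin m → ℝ) x :=
  Matrix.inv_eq_right_inv (P.gram_mul x)

/-- The matrix determinant lemma gives `h ^ m * (1 + k s / h)`, and `h + k s = 1` removes one factor
`h`. -/
theorem det_gram (x : E m) (hm : 1 ≤ m) :
    ((P.metric m).gram x).det = P.h (‖x‖ ^ 2) ^ (m - 1) := by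
  have h0 := (P.h_pos (‖x‖ ^ 2)).ne'
  have h1 := P.h_add (‖x‖ ^ 2)
  have e : (P.metric m).gram x = P.h (‖x‖ ^ 2) • (1 + Matrix.replicateCol Unit
      ((P.k (‖x‖ ^ 2) / P.h (‖x‖ ^ 2)) • (x : Fin m → ℝ))
        * Matrix.replicateRow Unit (x : Fin m → ℝ)) := by
    ext i j
    rw [gram_metric]
    simp [Matrix.mul_apply]
    field_simp
  rw [e, Matrix.det_smul, Matrix.det_one_add_replicateCol_mul_replicateRow]
  have : (x : Fin m → ℝ) ⬝ᵥ ((P.k (‖x‖ ^ 2) / P.h (‖x‖ ^ 2)) • (x : Fin m → ℝ))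
      = P.k (‖x‖ ^ 2) / P.h (‖x‖ ^ 2) * ‖x‖ ^ 2 := by
    rw [dotProduct_smul, smul_eq_mul, ← sum_sq x]
    rfl
  rw [this]
  obtain ⟨n, rfl⟩ : ∃ n, m = n + 1 := ⟨m - 1, by omega⟩
  simp only [Fintype.card_fin, Nat.add_sub_cancel, pow_succ]
  field_simp
  linarith

end RadialProfile
-- Calculus of radial functions and Christoffel symbols
theorem partialDeriv_add {F G : E m → ℝ} {x : E m} (hF : DifferentiableAt ℝ F x)
    (hG : DifferentiableAt ℝ G x) (i : Fin m) :
    partialDeriv i (fun y ↦ F y + G y) x = partialDeriv i F x + partialDeriv i G x := by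
  simp [partialDeriv, fderiv_fun_add hF hG]

theorem partialDeriv_mul {F G : E m → ℝ} {x : E m} (hF : DifferentiableAt ℝ F x)
    (hG : DifferentiableAt ℝ G x) (i : Fin m) :
    partialDeriv i (fun y ↦ F y * G y) x = partialDeriv i F x * G x + F x * partialDeriv i G x := by
  simp [partialDeriv, fderiv_fun_mul hF hG]
  ring

theorem partialDeriv_const (c : ℝ) (i : Fin m) (x : E m) :
    partialDeriv i (fun _ : E m ↦ c) x = 0 := by
  simp [partialDeriv]

theorem partialDeriv_coord (i j : Fin m) (x : E m) :
    partialDeriv i (fun y : E m ↦ y j) x = (1 : Matrix (Fin m) (Fin m) ℝ) i j := by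
  have h : HasFDerivAt (fun y : E m ↦ y j) (EuclideanSpace.proj (𝕜 := ℝ) j : E m →L[ℝ] ℝ) x :=
    (EuclideanSpace.proj (𝕜 := ℝ) j : E m →L[ℝ] ℝ).hasFDerivAt
  simp [partialDeriv, h.fderiv, Matrix.one_apply, eq_comm]

theorem contDiff_coord (j : Fin m) : ContDiff ℝ ∞ fun y : E m ↦ y j :=
  (EuclideanSpace.proj (𝕜 := ℝ) j : E m →L[ℝ] ℝ).contDiff

theorem contDiff_comp_norm_sq {u : ℝ → ℝ} (hu : ContDiff ℝ ∞ u) :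
    ContDiff ℝ ∞ fun y : E m ↦ u (‖y‖ ^ 2) :=
  hu.comp (contDiff_norm_sq ℝ)

theorem partialDeriv_comp_norm_sq {u : ℝ → ℝ} (hu : ContDiff ℝ ∞ u) (i : Fin m) (x : E m) :
    partialDeriv i (fun y : E m ↦ u (‖y‖ ^ 2)) x = deriv u (‖x‖ ^ 2) * (2 * x i) := by
  have h1 : HasFDerivAt (fun y : E m ↦ ‖y‖ ^ 2) (2 • innerSL ℝ x) x :=
    (hasStrictFDerivAt_norm_sq x).hasFDerivAt
  have h2 : HasDerivAt u (deriv u (‖x‖ ^ 2)) (‖x‖ ^ 2) :=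
    (hu.differentiable (by simp)).differentiableAt.hasDerivAt
  have h3 : HasFDerivAt (fun y : E m ↦ u (‖y‖ ^ 2)) (deriv u (‖x‖ ^ 2) • (2 • innerSL ℝ x)) x :=
    h2.comp_hasFDerivAt x h1
  rw [partialDeriv, h3.fderiv]
  simp [EuclideanSpace.inner_single_right]

theorem contDiff_deriv {u : ℝ → ℝ} (hu : ContDiff ℝ ∞ u) : ContDiff ℝ ∞ (deriv u) :=
  (contDiff_infty_iff_deriv.1 hu).2

namespace RadialProfile

variable (P : RadialProfile)

theorem contDiff_gram (i j : Fin m) : ContDiff ℝ ∞ fun x ↦ (P.metric m).gram x i j := by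
  simp only [gram_metric]
  exact ((contDiff_comp_norm_sq P.contDiff_h).mul contDiff_const).add
    ((contDiff_comp_norm_sq P.contDiff_k).mul ((contDiff_coord i).mul (contDiff_coord j)))

theorem cogram_metric (x : E m) (i j : Fin m) : (P.metric m).cogram x i j
    = (P.h (‖x‖ ^ 2))⁻¹ * (1 : Matrix (Fin m) (Fin m) ℝ) i j
      - P.k (‖x‖ ^ 2) / P.h (‖x‖ ^ 2) * (x i * x j) := by
  rw [cogram_metric_eq]
  simp [Matrix.vecMulVec_apply]

theorem contDiff_cogram (i j : Fin m) : ContDiff ℝ ∞ fun x ↦ (P.metric m).cogram x i j := by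
  simp only [cogram_metric]
  have hh := contDiff_comp_norm_sq (m := m) P.contDiff_h
  have hk := contDiff_comp_norm_sq (m := m) P.contDiff_k
  have h0 : ∀ x : E m, P.h (‖x‖ ^ 2) ≠ 0 := fun x ↦ (P.h_pos _).ne'
  exact ((hh.inv h0).mul contDiff_const).sub
    ((hk.div hh h0).mul ((contDiff_coord i).mul (contDiff_coord j)))

theorem contDiff_christoffel (k i j : Fin m) : ContDiff ℝ ∞ ((P.metric m).christoffel k i j) := by
  unfold Metric.christoffel
  refine contDiff_const.mul (ContDiff.sum fun l _ ↦ (P.contDiff_cogram k l).mul ?_)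
  exact ((contDiff_partialDeriv (P.contDiff_gram j l) i).add
    (contDiff_partialDeriv (P.contDiff_gram i l) j)).sub
    (contDiff_partialDeriv (P.contDiff_gram i j) l)

theorem partialDeriv_gram (l i j : Fin m) (x : E m) :
    partialDeriv l (fun y ↦ (P.metric m).gram y i j) x
      = deriv P.h (‖x‖ ^ 2) * (2 * x l) * (1 : Matrix (Fin m) (Fin m) ℝ) i j
        + (deriv P.k (‖x‖ ^ 2) * (2 * x l) * (x i * x j)
          + P.k (‖x‖ ^ 2) * ((1 : Matrix (Fin m) (Fin m) ℝ) l i * x j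
            + x i * (1 : Matrix (Fin m) (Fin m) ℝ) l j)) := by
  simp only [gram_metric]
  have d : ∀ {F : E m → ℝ}, ContDiff ℝ ∞ F → DifferentiableAt ℝ F x := fun hF ↦
    (hF.differentiable (by simp)).differentiableAt
  have hh := contDiff_comp_norm_sq (m := m) P.contDiff_h
  have hk := contDiff_comp_norm_sq (m := m) P.contDiff_k
  have hij := (contDiff_coord i).mul (contDiff_coord j)
  rw [partialDeriv_add (d (hh.mul contDiff_const)) (d (hk.mul hij)),
    partialDeriv_mul (d hh) (d contDiff_const), partialDeriv_mul (d hk) (d hij),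
    partialDeriv_mul (d (contDiff_coord i)) (d (contDiff_coord j)), partialDeriv_const,
    partialDeriv_comp_norm_sq P.contDiff_h, partialDeriv_comp_norm_sq P.contDiff_k,
    partialDeriv_coord, partialDeriv_coord]
  ring

/-- Where `h = 1` and `s > 0`, `h_add` forces `k = 0`: the metric is Euclidean outside the ball of
radius `R`. -/
theorem hasCompactSupport_christoffel {R : ℝ} (hR : 0 < R) (hP : ∀ s, R ^ 2 ≤ s → P.h s = 1)
    (k i j : Fin m) : HasCompactSupport ((P.metric m).christoffel k i j) := by
  refine HasCompactSupport.intro (isCompact_closedBall (0 : E m) R) fun x hx ↦ ?_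
  have hs : R ^ 2 < ‖x‖ ^ 2 := by
    rw [mem_closedBall_zero_iff, not_le] at hx
    exact pow_lt_pow_left₀ hx hR.le two_ne_zero
  have hk0 : ∀ s, R ^ 2 ≤ s → P.k s = 0 := fun s hs ↦ by
    have h1 := P.h_add s
    rw [hP s hs, add_eq_left] at h1
    exact (mul_eq_zero.1 h1).resolve_right ((pow_pos hR 2).trans_le hs).ne'
  have hh' : deriv P.h (‖x‖ ^ 2) = 0 := by
    rw [Filter.EventuallyEq.deriv_eq (f := fun _ ↦ (1 : ℝ))
      (Filter.eventuallyEq_of_mem (Ioi_mem_nhds hs) fun s hs ↦ hP s (le_of_lt hs))]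
    simp
  have hk' : deriv P.k (‖x‖ ^ 2) = 0 := by
    rw [Filter.EventuallyEq.deriv_eq (f := fun _ ↦ (0 : ℝ))
      (Filter.eventuallyEq_of_mem (Ioi_mem_nhds hs) fun s hs ↦ hk0 s (le_of_lt hs))]
    simp
  simp [Metric.christoffel, partialDeriv_gram, hh', hk', hk0 _ hs.le]

theorem isOpenManifold {R : ℝ} (hR : 0 < R) (hP : ∀ s, R ^ 2 ≤ s → P.h s = 1) (hm : 1 ≤ m) :
    (P.metric m).IsOpenManifold := by
  have : Nonempty (Fin m) := ⟨⟨0, hm⟩⟩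
  refine ⟨inferInstance, Metric.geodesicallyComplete_of_hasCompactSupport P.isUnit_det_gram
    (fun i j ↦ (P.contDiff_gram i j).differentiable (by simp)) P.contDiff_christoffel
    (P.hasCompactSupport_christoffel hR hP) P.sq_norm_le_bilin⟩

theorem isWarpedProduct {σ : ℝ → ℝ} (hσ : ∀ r, σ r ^ 2 = r ^ 2 * P.h (r ^ 2)) :
    (P.metric m).IsWarpedProduct σ := by
  intro x hx v w
  have hx0 : ‖x‖ ≠ 0 := norm_ne_zero_iff.2 hx
  rw [form_metric, bilin_apply, hσ]
  have h1 := P.h_add (‖x‖ ^ 2)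
  have hk : P.k (‖x‖ ^ 2) = (1 - P.h (‖x‖ ^ 2)) / ‖x‖ ^ 2 := by
    field_simp
    linarith
  rw [hk]
  field_simp
  ring

theorem sum_one_mul (x : E m) (i : Fin m) :
    ∑ l, (1 : Matrix (Fin m) (Fin m) ℝ) i l * x l = x i := by
  simp [Matrix.one_apply]

theorem sum_one_mul' (x : E m) (i : Fin m) :
    ∑ l, (1 : Matrix (Fin m) (Fin m) ℝ) l i * x l = x i := by
  simp [Matrix.one_apply]

/-- The radial direction is an eigenvector of the inverse metric with eigenvalue `1`. -/
theorem sum_cogram_mul (x : E m) (l : Fin m) : ∑ k, (P.metric m).cogram x k l * x k = x l := by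
  have h0 := (P.h_pos (‖x‖ ^ 2)).ne'
  have h1 := P.h_add (‖x‖ ^ 2)
  have e : ∀ k, (P.metric m).cogram x k l * x k
      = (P.h (‖x‖ ^ 2))⁻¹ * ((1 : Matrix (Fin m) (Fin m) ℝ) k l * x k)
        - P.k (‖x‖ ^ 2) / P.h (‖x‖ ^ 2) * x l * (x k * x k) := fun k ↦ by
    rw [cogram_metric]; ring
  simp only [e, Finset.sum_sub_distrib, ← Finset.mul_sum, sum_one_mul', sum_sq]
  field_simp
  linear_combination (-x l) * h1

/-- The derivative of `h_add`, used to eliminate `k'` from the Christoffel symbols. -/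
theorem deriv_h_add (s : ℝ) : deriv P.h s + deriv P.k s * s + P.k s = 0 := by
  have hh : HasDerivAt P.h (deriv P.h s) s :=
    (P.contDiff_h.differentiable (by simp)).differentiableAt.hasDerivAt
  have hk : HasDerivAt P.k (deriv P.k s) s :=
    (P.contDiff_k.differentiable (by simp)).differentiableAt.hasDerivAt
  have h1 := hh.add (hk.mul (hasDerivAt_id s))
  have h2 : P.h + P.k * id = fun _ ↦ (1 : ℝ) := funext P.h_add
  rw [h2] at h1
  have := h1.unique (hasDerivAt_const s (1 : ℝ))
  simp at this
  linarith

/-- The radial contraction of the Christoffel symbols. -/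
theorem sum_christoffel_mul (x : E m) (i j : Fin m) :
    ∑ k, (P.metric m).christoffel k i j x * x k
      = (deriv P.h (‖x‖ ^ 2) - P.k (‖x‖ ^ 2)) * (x i * x j)
        + (1 - P.h (‖x‖ ^ 2) - ‖x‖ ^ 2 * deriv P.h (‖x‖ ^ 2))
          * (1 : Matrix (Fin m) (Fin m) ℝ) i j := by
  set T : Fin m → ℝ := fun l ↦ partialDeriv i (fun y ↦ (P.metric m).gram y j l) x
    + partialDeriv j (fun y ↦ (P.metric m).gram y i l) x
    - partialDeriv l (fun y ↦ (P.metric m).gram y i j) x with hT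
  have e1 : ∑ k, (P.metric m).christoffel k i j x * x k = (1 / 2) * ∑ l, T l * x l := by
    calc ∑ k, (P.metric m).christoffel k i j x * x k
        = ∑ k, ∑ l, (1 / 2) * (T l * ((P.metric m).cogram x k l * x k)) := by
          refine Finset.sum_congr rfl fun k _ ↦ ?_
          rw [Metric.christoffel, Finset.mul_sum, Finset.sum_mul]
          exact Finset.sum_congr rfl fun l _ ↦ by ring
      _ = (1 / 2) * ∑ l, T l * x l := by
          rw [Finset.sum_comm]
          simp only [← Finset.mul_sum, sum_cogram_mul]
  have hsymm : (1 : Matrix (Fin m) (Fin m) ℝ) j i = (1 : Matrix (Fin m) (Fin m) ℝ) i j := by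
    simp [Matrix.one_apply, eq_comm]
  have e2 : ∀ l, T l * x l =
      deriv P.h (‖x‖ ^ 2) * 2 * x i * ((1 : Matrix (Fin m) (Fin m) ℝ) j l * x l)
      + deriv P.h (‖x‖ ^ 2) * 2 * x j * ((1 : Matrix (Fin m) (Fin m) ℝ) i l * x l)
      + ((2 * P.k (‖x‖ ^ 2) - 2 * deriv P.h (‖x‖ ^ 2)) * (1 : Matrix (Fin m) (Fin m) ℝ) i j
        + 2 * deriv P.k (‖x‖ ^ 2) * (x i * x j)) * (x l * x l)
      + P.k (‖x‖ ^ 2) * x j * ((1 : Matrix (Fin m) (Fin m) ℝ) i l * x l)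
      + P.k (‖x‖ ^ 2) * x i * ((1 : Matrix (Fin m) (Fin m) ℝ) j l * x l)
      - P.k (‖x‖ ^ 2) * x j * ((1 : Matrix (Fin m) (Fin m) ℝ) l i * x l)
      - P.k (‖x‖ ^ 2) * x i * ((1 : Matrix (Fin m) (Fin m) ℝ) l j * x l) := fun l ↦ by
    simp only [hT, partialDeriv_gram, hsymm]
    ring
  rw [e1]
  simp only [e2, Finset.sum_sub_distrib, Finset.sum_add_distrib, ← Finset.mul_sum, sum_one_mul,
    sum_one_mul', sum_sq]
  have h1 := P.h_add (‖x‖ ^ 2)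
  have h2 := P.deriv_h_add (‖x‖ ^ 2)
  linear_combination (x i * x j) * h2 + (1 : Matrix (Fin m) (Fin m) ℝ) i j * h1

/-! ### Hessian and Laplacian of radial functions -/

theorem hessian_radial {φ : ℝ → ℝ} (hφ : ContDiff ℝ ∞ φ) (x : E m) (i j : Fin m) :
    (P.metric m).hessian (fun y ↦ φ (‖y‖ ^ 2)) x i j
      = 2 * deriv φ (‖x‖ ^ 2) * (P.h (‖x‖ ^ 2) + ‖x‖ ^ 2 * deriv P.h (‖x‖ ^ 2))
          * (1 : Matrix (Fin m) (Fin m) ℝ) i j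
        + (4 * deriv (deriv φ) (‖x‖ ^ 2)
          - 2 * deriv φ (‖x‖ ^ 2) * (deriv P.h (‖x‖ ^ 2) - P.k (‖x‖ ^ 2))) * (x i * x j) := by
  have hφ' := contDiff_deriv hφ
  have d : ∀ {F : E m → ℝ}, ContDiff ℝ ∞ F → DifferentiableAt ℝ F x := fun hF ↦
    (hF.differentiable (by simp)).differentiableAt
  have hp : ∀ j, partialDeriv j (fun y : E m ↦ φ (‖y‖ ^ 2))
      = fun y ↦ deriv φ (‖y‖ ^ 2) * (2 * y j) := fun j ↦
    funext fun y ↦ partialDeriv_comp_norm_sq hφ j y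
  simp only [Metric.hessian, Matrix.of_apply, hp]
  have e : ∑ k, (P.metric m).christoffel k i j x * (deriv φ (‖x‖ ^ 2) * (2 * x k))
      = 2 * deriv φ (‖x‖ ^ 2) * ∑ k, (P.metric m).christoffel k i j x * x k := by
    rw [Finset.mul_sum]
    exact Finset.sum_congr rfl fun k _ ↦ by ring
  rw [e, sum_christoffel_mul, partialDeriv_mul (d (contDiff_comp_norm_sq hφ'))
    (d (contDiff_const.mul (contDiff_coord j))), partialDeriv_comp_norm_sq hφ',
    partialDeriv_mul (d contDiff_const) (d (contDiff_coord j)), partialDeriv_const,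
    partialDeriv_coord]
  ring

/-- The pairing of two matrices in the span of `1` and `x xᵀ`. -/
theorem sum_sum_mul (x : E m) (a b c d : ℝ) :
    ∑ i, ∑ j, (a * (1 : Matrix (Fin m) (Fin m) ℝ) i j + b * (x i * x j))
        * (c * (1 : Matrix (Fin m) (Fin m) ℝ) i j + d * (x i * x j))
      = a * c * m + (a * d + b * c) * ‖x‖ ^ 2 + b * d * (‖x‖ ^ 2) ^ 2 := by
  have e : ∀ i j, (a * (1 : Matrix (Fin m) (Fin m) ℝ) i j + b * (x i * x j))
        * (c * (1 : Matrix (Fin m) (Fin m) ℝ) i j + d * (x i * x j))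
      = a * c * (1 : Matrix (Fin m) (Fin m) ℝ) i j
        + (a * d + b * c) * x i * ((1 : Matrix (Fin m) (Fin m) ℝ) i j * x j)
        + b * d * (x i * x i) * (x j * x j) := fun i j ↦ by
    have : (1 : Matrix (Fin m) (Fin m) ℝ) i j * (1 : Matrix (Fin m) (Fin m) ℝ) i j
      = (1 : Matrix (Fin m) (Fin m) ℝ) i j := by simp [Matrix.one_apply]
    linear_combination (a * c) * this
  have e1 : ∀ i, ∑ j, (1 : Matrix (Fin m) (Fin m) ℝ) i j = 1 := fun i ↦ by simp [Matrix.one_apply]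
  have row : ∀ i, ∑ j, (a * (1 : Matrix (Fin m) (Fin m) ℝ) i j + b * (x i * x j))
        * (c * (1 : Matrix (Fin m) (Fin m) ℝ) i j + d * (x i * x j))
      = a * c + (a * d + b * c + b * d * ‖x‖ ^ 2) * (x i * x i) := fun i ↦ by
    simp only [e, Finset.sum_add_distrib, ← Finset.mul_sum, sum_one_mul, sum_sq, e1]
    ring
  simp only [row, Finset.sum_add_distrib, ← Finset.mul_sum, sum_sq, Finset.sum_const,
    Finset.card_univ, Fintype.card_fin, nsmul_eq_mul]
  ring

theorem laplacian_radial {φ : ℝ → ℝ} (hφ : ContDiff ℝ ∞ φ) (x : E m) :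
    (P.metric m).laplacian (fun y ↦ φ (‖y‖ ^ 2)) x
      = 2 * deriv φ (‖x‖ ^ 2) + 4 * ‖x‖ ^ 2 * deriv (deriv φ) (‖x‖ ^ 2)
        + (m - 1) * (2 * deriv φ (‖x‖ ^ 2)
          * (1 + ‖x‖ ^ 2 * (deriv P.h (‖x‖ ^ 2) / P.h (‖x‖ ^ 2)))) := by
  have h0 := (P.h_pos (‖x‖ ^ 2)).ne'
  have h1 := P.h_add (‖x‖ ^ 2)
  simp only [Metric.laplacian, cogram_metric, hessian_radial P hφ, sub_eq_add_neg, ← neg_mul]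
  rw [sum_sum_mul]
  generalize P.h (‖x‖ ^ 2) = h at *
  generalize P.k (‖x‖ ^ 2) = k at *
  generalize ‖x‖ ^ 2 = s at *
  -- The trace splits into `m - 1` spherical eigenvalues `a / h` and one radial eigenvalue `a + b
  -- s`.
  have key : ∀ a b : ℝ, h⁻¹ * a * m + (h⁻¹ * b + -(k / h) * a) * s + -(k / h) * b * s ^ 2
      = (m - 1) * (a / h) + (a + b * s) := fun a b ↦ by
    field_simp
    linear_combination (-(a + b * s)) * h1
  rw [key]
  field_simp
  linear_combination (2 * deriv φ s * h) * h1

theorem one_comm (i j : Fin m) :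
    (1 : Matrix (Fin m) (Fin m) ℝ) i j = (1 : Matrix (Fin m) (Fin m) ℝ) j i := by
  simp [Matrix.one_apply, eq_comm]

/-- The product of two matrices in the span of `1` and `x xᵀ`. -/
theorem sum_mul_span (x : E m) (a b c d : ℝ) (k j : Fin m) :
    ∑ i, (a * (1 : Matrix (Fin m) (Fin m) ℝ) i k + b * (x i * x k))
        * (c * (1 : Matrix (Fin m) (Fin m) ℝ) i j + d * (x i * x j))
      = a * c * (1 : Matrix (Fin m) (Fin m) ℝ) k j
        + (a * d + b * c + b * d * ‖x‖ ^ 2) * (x k * x j) := by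
  have e : ∀ i, (a * (1 : Matrix (Fin m) (Fin m) ℝ) i k + b * (x i * x k))
        * (c * (1 : Matrix (Fin m) (Fin m) ℝ) i j + d * (x i * x j))
      = a * c * ((1 : Matrix (Fin m) (Fin m) ℝ) i k * (1 : Matrix (Fin m) (Fin m) ℝ) i j)
        + a * d * x j * ((1 : Matrix (Fin m) (Fin m) ℝ) i k * x i)
        + b * c * x k * ((1 : Matrix (Fin m) (Fin m) ℝ) i j * x i)
        + b * d * (x k * x j) * (x i * x i) := fun i ↦ by ring
  have e1 : ∑ i, (1 : Matrix (Fin m) (Fin m) ℝ) i k * (1 : Matrix (Fin m) (Fin m) ℝ) i j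
      = (1 : Matrix (Fin m) (Fin m) ℝ) k j := by simp [Matrix.one_apply, eq_comm]
  simp only [e, Finset.sum_add_distrib, ← Finset.mul_sum, sum_one_mul', sum_sq, e1]
  ring

/-- The eigenvalue of the Hessian of a radial function in spherical directions bounds its norm. -/
theorem le_hessianNorm_radial (hm : 2 ≤ m) {φ : ℝ → ℝ} (hφ : ContDiff ℝ ∞ φ) (x : E m) :
    |2 * deriv φ (‖x‖ ^ 2) * (1 + ‖x‖ ^ 2 * (deriv P.h (‖x‖ ^ 2) / P.h (‖x‖ ^ 2)))|
      ≤ (P.metric m).hessianNorm (fun y ↦ φ (‖y‖ ^ 2)) x := by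
  have h0 := (P.h_pos (‖x‖ ^ 2)).ne'
  have h1 := P.h_add (‖x‖ ^ 2)
  have hm' : (2 : ℝ) ≤ m := by exact_mod_cast hm
  rw [Metric.hessianNorm]
  refine Real.le_sqrt_of_sq_le ?_
  rw [sq_abs]
  set a := 2 * deriv φ (‖x‖ ^ 2) * (P.h (‖x‖ ^ 2) + ‖x‖ ^ 2 * deriv P.h (‖x‖ ^ 2)) with ha
  set b := 4 * deriv (deriv φ) (‖x‖ ^ 2)
          - 2 * deriv φ (‖x‖ ^ 2) * (deriv P.h (‖x‖ ^ 2) - P.k (‖x‖ ^ 2)) with hb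
  have hp : 2 * deriv φ (‖x‖ ^ 2) * (1 + ‖x‖ ^ 2 * (deriv P.h (‖x‖ ^ 2) / P.h (‖x‖ ^ 2)))
      = (P.h (‖x‖ ^ 2))⁻¹ * a := by
    rw [ha]
    field_simp
  rw [hp]
  set u := (P.h (‖x‖ ^ 2))⁻¹ with hu
  set w := -(P.k (‖x‖ ^ 2) / P.h (‖x‖ ^ 2)) with hw
  have hH : ∀ i j, (P.metric m).hessian (fun y ↦ φ (‖y‖ ^ 2)) x i j
      = a * (1 : Matrix (Fin m) (Fin m) ℝ) i j + b * (x i * x j) := P.hessian_radial hφ x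
  have hC : ∀ i j, (P.metric m).cogram x i j
      = u * (1 : Matrix (Fin m) (Fin m) ℝ) i j + w * (x i * x j) := fun i j ↦ by
    rw [cogram_metric]; ring
  set q := u * b + w * a + w * b * ‖x‖ ^ 2 with hq
  have e1 : ∀ k j, ∑ i, (P.metric m).cogram x i k
        * (P.metric m).hessian (fun y ↦ φ (‖y‖ ^ 2)) x i j
      = u * a * (1 : Matrix (Fin m) (Fin m) ℝ) k j + q * (x k * x j) := fun k j ↦ by
    simp only [hH, hC, sum_mul_span, hq]
  have e2 : ∀ k j, ∑ l, (P.metric m).cogram x j l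
        * (P.metric m).hessian (fun y ↦ φ (‖y‖ ^ 2)) x k l
      = u * a * (1 : Matrix (Fin m) (Fin m) ℝ) k j + q * (x k * x j) := fun k j ↦ by
    rw [one_comm k j, mul_comm (x k), ← e1 j k]
    refine Finset.sum_congr rfl fun l _ ↦ ?_
    simp only [hH, hC, one_comm l, mul_comm (x l)]
  have e3 : ∑ i, ∑ j, ∑ k, ∑ l, (P.metric m).cogram x i k * (P.metric m).cogram x j l
        * (P.metric m).hessian (fun y ↦ φ (‖y‖ ^ 2)) x i j
        * (P.metric m).hessian (fun y ↦ φ (‖y‖ ^ 2)) x k l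
      = u * a * (u * a) * m + (u * a * q + q * (u * a)) * ‖x‖ ^ 2 + q * q * (‖x‖ ^ 2) ^ 2 := by
    rw [← sum_sum_mul x]
    calc _ = ∑ k, ∑ j, (∑ i, (P.metric m).cogram x i k
              * (P.metric m).hessian (fun y ↦ φ (‖y‖ ^ 2)) x i j)
            * ∑ l, (P.metric m).cogram x j l
              * (P.metric m).hessian (fun y ↦ φ (‖y‖ ^ 2)) x k l := by
          simp only [Finset.sum_mul_sum]
          rw [Finset.sum_congr rfl fun i _ ↦ Finset.sum_comm, Finset.sum_comm]
          refine Finset.sum_congr rfl fun k _ ↦ ?_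
          rw [Finset.sum_comm]
          exact Finset.sum_congr rfl fun j _ ↦ Finset.sum_congr rfl fun i _ ↦
            Finset.sum_congr rfl fun l _ ↦ by ring
      _ = _ := by simp only [e1, e2]
  rw [e3]
  -- The sum equals `(m - 1) (u a)² + (u a + q |x|²)²`, and `m ≥ 2` leaves at least one spherical
  -- square.
  nlinarith [sq_nonneg (u * a + q * ‖x‖ ^ 2), mul_nonneg (sub_nonneg.2 hm') (sq_nonneg (u * a))]

end RadialProfile
-- The oscillating profile and its potential
/-- A cutoff function equal to `1` on `[3/2, 7/2]` and vanishing outside `(1, 4)`. -/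
noncomputable def cutoff : ContDiffBump (5 / 2 : ℝ) := ⟨1, 3 / 2, one_pos, by norm_num⟩

theorem contDiff_cutoff : ContDiff ℝ ∞ cutoff := cutoff.contDiff

theorem cutoff_eq_zero_of_le {s : ℝ} (hs : s ≤ 1) : cutoff s = 0 := by
  refine cutoff.zero_of_le_dist ?_
  rw [Real.dist_eq, abs_sub_comm]
  exact le_trans (by simp only [cutoff]; linarith) (le_abs_self _)

theorem cutoff_eq_zero_of_ge {s : ℝ} (hs : 4 ≤ s) : cutoff s = 0 := by
  refine cutoff.zero_of_le_dist ?_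
  rw [Real.dist_eq]
  exact le_trans (by simp only [cutoff]; linarith) (le_abs_self _)

theorem cutoff_eq_one {s : ℝ} (h2 : 2 ≤ s) (h3 : s ≤ 3) : cutoff s = 1 := by
  refine cutoff.one_of_mem_closedBall ?_
  rw [Metric.mem_closedBall, Real.dist_eq, abs_le]
  constructor <;> simp only [cutoff] <;> linarith

/-- An oscillating function of frequency `N` and phase `θ` supported in `[1, 4]`. -/
noncomputable def wave (N θ s : ℝ) : ℝ := cutoff s * (1 + Real.sin (N * s + θ))

theorem contDiff_wave (N θ : ℝ) : ContDiff ℝ ∞ (wave N θ) := by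
  refine contDiff_cutoff.mul (contDiff_const.add (Real.contDiff_sin.comp ?_))
  fun_prop

theorem wave_nonneg (N θ s : ℝ) : 0 ≤ wave N θ s :=
  mul_nonneg cutoff.nonneg (by linarith [Real.neg_one_le_sin (N * s + θ)])

theorem wave_le_two (N θ s : ℝ) : wave N θ s ≤ 2 := by
  have h1 : wave N θ s ≤ 1 * (1 + Real.sin (N * s + θ)) :=
    mul_le_mul_of_nonneg_right cutoff.le_one (by linarith [Real.neg_one_le_sin (N * s + θ)])
  linarith [Real.sin_le_one (N * s + θ)]

theorem wave_eq_zero {N θ s : ℝ} (hs : cutoff s = 0) : wave N θ s = 0 := by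
  simp [wave, hs]

theorem deriv_wave {N θ s : ℝ} (h2 : 2 < s) (h3 : s < 3) :
    deriv (wave N θ) s = N * Real.cos (N * s + θ) := by
  have h : wave N θ =ᶠ[nhds s] fun s ↦ 1 + Real.sin (N * s + θ) :=
    Filter.eventuallyEq_of_mem (Ioo_mem_nhds h2 h3) fun t ht ↦ by
      simp [wave, cutoff_eq_one ht.1.le ht.2.le]
  have hd : HasDerivAt (fun s ↦ 1 + Real.sin (N * s + θ)) (Real.cos (N * s + θ) * (N * 1)) s :=
    ((((hasDerivAt_id s).const_mul N).add_const θ).sin).const_add 1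
  rw [h.deriv_eq, hd.deriv]
  ring

/-- The profile `h = exp (2 * wave)`. -/
noncomputable def waveProfile (N θ : ℝ) : RadialProfile where
  h s := Real.exp (2 * wave N θ s)
  k s := (1 - Real.exp (2 * wave N θ s)) / s
  contDiff_h := Real.contDiff_exp.comp (contDiff_const.mul (contDiff_wave N θ))
  contDiff_k := by
    refine contDiff_iff_contDiffAt.2 fun s ↦ ?_
    -- The quotient is harmless at `0`: the wave vanishes for `s ≤ 1`, so `k` is identically `0`
    -- there.
    rcases lt_or_ge s 1 with hs | hs
    · refine (contDiffAt_const (c := (0 : ℝ))).congr_of_eventuallyEq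
        (Filter.eventuallyEq_of_mem (Iio_mem_nhds hs) fun t ht ↦ ?_)
      simp [wave_eq_zero (cutoff_eq_zero_of_le (le_of_lt ht))]
    · exact (contDiff_const.sub (Real.contDiff_exp.comp
        (contDiff_const.mul (contDiff_wave N θ)))).contDiffAt.div contDiffAt_id (by simp; linarith)
  one_le_h s := Real.one_le_exp (by linarith [wave_nonneg N θ s])
  h_add s := by
    rcases eq_or_ne s 0 with rfl | hs
    · simp [wave_eq_zero (cutoff_eq_zero_of_le zero_le_one)]
    · field_simp
      ring

theorem waveProfile_h (N θ s : ℝ) : (waveProfile N θ).h s = Real.exp (2 * wave N θ s) := rfl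

theorem waveProfile_h_eq_one {N θ s : ℝ} (hs : 4 ≤ s) : (waveProfile N θ).h s = 1 := by
  simp [waveProfile_h, wave_eq_zero (cutoff_eq_zero_of_ge hs)]

theorem logDeriv_waveProfile_h (N θ s : ℝ) :
    deriv (waveProfile N θ).h s / (waveProfile N θ).h s = 2 * deriv (wave N θ) s := by
  have hd : HasDerivAt (wave N θ) (deriv (wave N θ) s) s :=
    ((contDiff_wave N θ).differentiable (by simp)).differentiableAt.hasDerivAt
  have h1 : HasDerivAt (waveProfile N θ).h _ s := (hd.const_mul 2).exp
  rw [h1.deriv, waveProfile_h]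
  field_simp

/-- The derivative of the radial potential. -/
noncomputable def gradientProfile (m : ℕ) (N θ s : ℝ) : ℝ :=
  cutoff s * Real.exp (-(m - 1) * wave N θ s)

theorem contDiff_gradientProfile (m : ℕ) (N θ : ℝ) : ContDiff ℝ ∞ (gradientProfile m N θ) :=
  contDiff_cutoff.mul (Real.contDiff_exp.comp (contDiff_const.mul (contDiff_wave N θ)))

theorem exp_wave_le_one (hm : 1 ≤ m) (N θ s : ℝ) : Real.exp (-(m - 1) * wave N θ s) ≤ 1 := by
  have hm' : (1 : ℝ) ≤ m := by exact_mod_cast hm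
  rw [Real.exp_le_one_iff]
  nlinarith [wave_nonneg N θ s]

theorem abs_gradientProfile_le_one (hm : 1 ≤ m) (N θ s : ℝ) : |gradientProfile m N θ s| ≤ 1 := by
  have h0 : 0 ≤ gradientProfile m N θ s := mul_nonneg cutoff.nonneg (Real.exp_pos _).le
  rw [abs_of_nonneg h0]
  exact mul_le_one₀ cutoff.le_one (Real.exp_pos _).le (exp_wave_le_one hm N θ s)

/-- The radial potential, as a function of `|x|²`. -/
noncomputable def potential (m : ℕ) (N θ s : ℝ) : ℝ := ∫ t in (4 : ℝ)..s, gradientProfile m N θ t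

theorem hasDerivAt_potential (m : ℕ) (N θ s : ℝ) :
    HasDerivAt (potential m N θ) (gradientProfile m N θ s) s :=
  intervalIntegral.integral_hasDerivAt_right
    ((contDiff_gradientProfile m N θ).continuous.intervalIntegrable _ _)
    ((contDiff_gradientProfile m N θ).continuous.stronglyMeasurableAtFilter _ _)
    (contDiff_gradientProfile m N θ).continuous.continuousAt

theorem deriv_potential (m : ℕ) (N θ : ℝ) : deriv (potential m N θ) = gradientProfile m N θ :=
  funext fun s ↦ (hasDerivAt_potential m N θ s).deriv

theorem contDiff_potential (m : ℕ) (N θ : ℝ) : ContDiff ℝ ∞ (potential m N θ) := by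
  rw [contDiff_infty_iff_deriv, deriv_potential]
  exact ⟨fun s ↦ (hasDerivAt_potential m N θ s).differentiableAt, contDiff_gradientProfile m N θ⟩

/-- The base point `4` of the integral lies at the outer edge of the cutoff; this makes the
potential compactly supported in `x`. -/
theorem potential_eq_zero {N θ s : ℝ} (hs : 4 ≤ s) : potential m N θ s = 0 := by
  rw [potential, intervalIntegral.integral_congr (g := fun _ ↦ (0 : ℝ)) fun t ht ↦ ?_]
  · simp
  · rw [Set.uIcc_of_le hs] at ht
    simp [gradientProfile, cutoff_eq_zero_of_ge ht.1]

theorem abs_potential_le (hm : 1 ≤ m) {N θ s : ℝ} (hs : 0 ≤ s) (hs' : s ≤ 4) :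
    |potential m N θ s| ≤ 4 := by
  have := intervalIntegral.norm_integral_le_of_norm_le_const (a := 4) (b := s) (C := 1)
    (f := gradientProfile m N θ) fun t _ ↦ abs_gradientProfile_le_one hm N θ t
  refine this.trans ?_
  rw [one_mul, abs_le]
  constructor <;> linarith

theorem deriv_gradientProfile (m : ℕ) (N θ s : ℝ) : deriv (gradientProfile m N θ) s
    = (deriv cutoff s - (m - 1) * deriv (wave N θ) s * cutoff s)
      * Real.exp (-(m - 1) * wave N θ s) := by
  have hw : HasDerivAt (wave N θ) (deriv (wave N θ) s) s :=
    ((contDiff_wave N θ).differentiable (by simp)).differentiableAt.hasDerivAt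
  have hc : HasDerivAt cutoff (deriv cutoff s) s :=
    (contDiff_cutoff.differentiable (by simp)).differentiableAt.hasDerivAt
  have h1 : HasDerivAt (gradientProfile m N θ) _ s := hc.mul (hw.const_mul (-((m : ℝ) - 1))).exp
  rw [h1.deriv]
  ring

/-- The Laplacian of the potential does not see the derivative of the oscillation. -/
theorem laplacian_potential (N θ : ℝ) (x : E m) :
    ((waveProfile N θ).metric m).laplacian (fun y ↦ potential m N θ (‖y‖ ^ 2)) x
      = (4 * ‖x‖ ^ 2 * deriv cutoff (‖x‖ ^ 2) + 2 * m * cutoff (‖x‖ ^ 2))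
        * Real.exp (-(m - 1) * wave N θ (‖x‖ ^ 2)) := by
  -- The two terms `± 4 (m - 1) s w' φ'`, from `φ''` and from `h' / h = 2 w'`, cancel in the final
  -- `ring`.
  rw [(waveProfile N θ).laplacian_radial (contDiff_potential m N θ), deriv_potential,
    deriv_gradientProfile, logDeriv_waveProfile_h, gradientProfile]
  ring

/-- `B` precedes `N` and `θ`: a fixed compactly supported function of `s` is multiplied by an
exponential that is at most `1`. -/
theorem exists_abs_laplacian_potential_le (hm : 1 ≤ m) : ∃ B : ℝ, ∀ (N θ : ℝ) (x : E m),
    |((waveProfile N θ).metric m).laplacian (fun y ↦ potential m N θ (‖y‖ ^ 2)) x| ≤ B := by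
  have hcont : Continuous fun s : ℝ ↦ 4 * s * deriv cutoff s + 2 * m * cutoff s := by
    have := contDiff_cutoff.continuous
    have := (contDiff_deriv contDiff_cutoff).continuous
    fun_prop
  have hsupp : HasCompactSupport fun s : ℝ ↦ 4 * s * deriv cutoff s + 2 * m * cutoff s :=
    (cutoff.hasCompactSupport.deriv.mul_left).add cutoff.hasCompactSupport.mul_left
  obtain ⟨B, hB⟩ := hcont.bounded_above_of_compact_support hsupp
  refine ⟨B, fun N θ x ↦ ?_⟩
  rw [laplacian_potential, abs_mul, Real.abs_exp]
  exact (mul_le_of_le_one_right (abs_nonneg _) (exp_wave_le_one hm N θ _)).trans (hB _)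

theorem laplacian_potential_eq_zero {N θ : ℝ} {x : E m} (hx : 2 < ‖x‖) :
    ((waveProfile N θ).metric m).laplacian (fun y ↦ potential m N θ (‖y‖ ^ 2)) x = 0 := by
  have hs : 4 < ‖x‖ ^ 2 := by nlinarith
  have hc' : deriv cutoff (‖x‖ ^ 2) = 0 := by
    rw [Filter.EventuallyEq.deriv_eq (f := fun _ ↦ (0 : ℝ))
      (Filter.eventuallyEq_of_mem (Ioi_mem_nhds hs) fun s hs ↦ cutoff_eq_zero_of_ge (le_of_lt hs))]
    simp
  rw [laplacian_potential, hc', cutoff_eq_zero_of_ge hs.le]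
  simp

theorem le_hessianNorm_potential (hm : 2 ≤ m) {N θ : ℝ} (hN : 1 ≤ N) {x : E m}
    (h2 : 2 < ‖x‖ ^ 2) (h3 : ‖x‖ ^ 2 < 3) (hcos : 1 / 2 ≤ |Real.cos (N * ‖x‖ ^ 2 + θ)|) :
    Real.exp (-(2 * (m - 1))) * N
      ≤ ((waveProfile N θ).metric m).hessianNorm (fun y ↦ potential m N θ (‖y‖ ^ 2)) x := by
  refine le_trans ?_ ((waveProfile N θ).le_hessianNorm_radial hm (contDiff_potential m N θ) x)
  have hm' : (2 : ℝ) ≤ m := by exact_mod_cast hm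
  rw [deriv_potential, logDeriv_waveProfile_h, deriv_wave h2 h3, gradientProfile,
    cutoff_eq_one h2.le h3.le, one_mul, abs_mul, abs_mul, Real.abs_exp]
  generalize ‖x‖ ^ 2 = s at *
  have he : Real.exp (-(2 * (m - 1))) ≤ Real.exp (-(m - 1) * wave N θ s) := by
    rw [Real.exp_le_exp]
    nlinarith [wave_le_two N θ s]
  -- From `s > 2` and `|cos| ≥ 1/2` the oscillating term is at least `2N`; losing `1` still leaves
  -- `N`, as `N ≥ 1`.
  have habs : N ≤ |1 + s * (2 * (N * Real.cos (N * s + θ)))| := by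
    have h1 : |s * (2 * (N * Real.cos (N * s + θ)))| = s * (2 * (N * |Real.cos (N * s + θ)|)) := by
      rw [abs_mul, abs_mul, abs_mul, abs_of_pos (by linarith : 0 < s),
        abs_of_pos (by linarith : 0 < N), abs_two]
    have h4 : |s * (2 * (N * Real.cos (N * s + θ)))| - |(-1 : ℝ)|
        ≤ |s * (2 * (N * Real.cos (N * s + θ))) - (-1)| := abs_sub_abs_le_abs_sub _ _
    have h5 : 2 * N ≤ s * (2 * (N * |Real.cos (N * s + θ)|)) := by
      have : N * (1 / 2) ≤ N * |Real.cos (N * s + θ)| :=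
        mul_le_mul_of_nonneg_left hcos (by linarith)
      nlinarith
    rw [h1, abs_neg, abs_one, sub_neg_eq_add, add_comm _ (1 : ℝ)] at h4
    linarith
  have hpos := Real.exp_pos (-((m : ℝ) - 1) * wave N θ s)
  calc Real.exp (-(2 * (m - 1))) * N
      ≤ Real.exp (-(m - 1) * wave N θ s) * |1 + s * (2 * (N * Real.cos (N * s + θ)))| :=
        mul_le_mul he habs (by linarith) hpos.le
    _ ≤ _ := by
      rw [abs_two]
      nlinarith [mul_nonneg hpos.le (abs_nonneg (1 + s * (2 * (N * Real.cos (N * s + θ)))))]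

/-! ### Bounds for powers of `L^p` norms -/

namespace Metric

theorem lpPow_mono (g : Metric m) (p : ℝ≥0∞) {F G : E m → ℝ} (h : ∀ x, ‖F x‖ ≤ ‖G x‖) :
    g.lpPow p F ≤ g.lpPow p G := by
  unfold lpPow
  split_ifs
  · exact eLpNorm_mono h
  · exact ENNReal.rpow_le_rpow (eLpNorm_mono h) ENNReal.toReal_nonneg

theorem lpPow_indicator_const (g : Metric m) {p : ℝ≥0∞} (hp : 1 ≤ p) (hp' : p ≠ ⊤)
    {A : Set (E m)} (hA : MeasurableSet A) (c : ℝ) :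
    g.lpPow p (A.indicator fun _ ↦ c) = ‖c‖ₑ ^ p.toReal * g.vol A := by
  have hp0 : p ≠ 0 := (one_pos.trans_le hp).ne'
  have hpr : p.toReal ≠ 0 := ENNReal.toReal_ne_zero.2 ⟨hp0, hp'⟩
  rw [lpPow, if_neg hp', eLpNorm_indicator_const hA hp0 hp',
    ENNReal.mul_rpow_of_nonneg _ _ ENNReal.toReal_nonneg, ← ENNReal.rpow_mul,
    one_div_mul_cancel hpr, ENNReal.rpow_one]

/-- A lower bound linear in `K` and uniform in `p`: `K ≥ 1` gives `K ≤ K ^ p`, and `c ≤ 1` lets the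
same bound serve `p = ∞`. -/
theorem le_lpPow (g : Metric m) {p : ℝ≥0∞} (hp : 1 ≤ p) {A : Set (E m)} (hA : MeasurableSet A)
    {K : ℝ} (hK : 1 ≤ K) {F : E m → ℝ} (hF : ∀ x ∈ A, K ≤ |F x|) {c : ℝ≥0∞} (hc0 : c ≠ 0)
    (hc1 : c ≤ 1) (hc : c ≤ g.vol A) : ENNReal.ofReal K * c ≤ g.lpPow p F := by
  have hKn : ‖K‖ₑ = ENNReal.ofReal K := Real.enorm_of_nonneg (by linarith)
  have hmono : g.lpPow p (A.indicator fun _ ↦ K) ≤ g.lpPow p F := by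
    refine g.lpPow_mono p fun x ↦ ?_
    by_cases hx : x ∈ A
    · rw [Set.indicator_of_mem hx, Real.norm_of_nonneg (by linarith)]
      exact hF x hx
    · simp [Set.indicator_of_notMem hx]
  refine le_trans ?_ hmono
  by_cases hp' : p = ⊤
  · have hA0 : g.vol A ≠ 0 := fun h ↦ hc0 (le_antisymm (hc.trans h.le) zero_le)
    rw [lpPow, if_pos hp', eLpNorm_exponent_top, eLpNormEssSup_indicator_const_eq _ _ hA0, hKn]
    exact mul_le_of_le_one_right' hc1
  · rw [g.lpPow_indicator_const hp hp' hA, hKn]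
    have h1 : 1 ≤ p.toReal := by
      rw [← ENNReal.toReal_one]
      exact ENNReal.toReal_mono hp' hp
    have h2 : ENNReal.ofReal K ≤ ENNReal.ofReal K ^ p.toReal := by
      have := ENNReal.rpow_le_rpow_of_exponent_le
        (ENNReal.one_le_ofReal.2 hK) h1
      rwa [ENNReal.rpow_one] at this
    exact mul_le_mul' h2 hc

theorem lpPow_le (g : Metric m) {p : ℝ≥0∞} (hp : 1 ≤ p) {S : Set (E m)} (hS : MeasurableSet S)
    {B : ℝ} {F : E m → ℝ} (hF : ∀ x ∈ S, |F x| ≤ B) (hF0 : ∀ x, x ∉ S → F x = 0)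
    {V : ℝ≥0∞} (hV1 : 1 ≤ V) (hV : g.vol S ≤ V) :
    g.lpPow p F ≤ (if p = ⊤ then ‖B‖ₑ else ‖B‖ₑ ^ p.toReal) * V := by
  have hmono : g.lpPow p F ≤ g.lpPow p (S.indicator fun _ ↦ B) := by
    refine g.lpPow_mono p fun x ↦ ?_
    by_cases hx : x ∈ S
    · rw [Set.indicator_of_mem hx]
      exact (hF x hx).trans (le_abs_self B)
    · simp [hF0 x hx]
  refine hmono.trans ?_
  split_ifs with hp'
  · rw [lpPow, if_pos hp', eLpNorm_exponent_top]
    exact (eLpNormEssSup_indicator_const_le S B).trans (le_mul_of_one_le_right' hV1)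
  · rw [g.lpPow_indicator_const hp hp' hS]
    exact mul_le_mul_right hV _

end Metric

/-! ### Volume comparison and the steep part of the shell -/

theorem volume_le_vol_wave (hm : 1 ≤ m) (N θ : ℝ) (A : Set (E m)) :
    volume A ≤ ((waveProfile N θ).metric m).vol A := by
  have h : (volume : Measure (E m)) ≤ ((waveProfile N θ).metric m).vol := by
    rw [Metric.vol]
    conv_lhs => rw [← withDensity_one (μ := (volume : Measure (E m)))]
    refine withDensity_mono (Filter.Eventually.of_forall fun x ↦ ?_)
    rw [Pi.one_apply, ENNReal.one_le_ofReal, Real.one_le_sqrt, RadialProfile.det_gram _ x hm]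
    exact one_le_pow₀ ((waveProfile N θ).one_le_h _)
  exact h A

/-- The constant is independent of `N` and `θ`: `wave ≤ 2` gives `h ≤ exp 4`. -/
theorem vol_wave_le (hm : 1 ≤ m) (N θ : ℝ) (A : Set (E m)) :
    ((waveProfile N θ).metric m).vol A
      ≤ ENNReal.ofReal (Real.sqrt (Real.exp 4 ^ (m - 1))) * volume A := by
  have h : ((waveProfile N θ).metric m).vol
      ≤ ENNReal.ofReal (Real.sqrt (Real.exp 4 ^ (m - 1))) • (volume : Measure (E m)) := by
    rw [Metric.vol, ← withDensity_const]
    refine withDensity_mono (Filter.Eventually.of_forall fun x ↦ ?_)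
    refine ENNReal.ofReal_le_ofReal (Real.sqrt_le_sqrt ?_)
    rw [RadialProfile.det_gram _ x hm]
    refine pow_le_pow_left₀ ((waveProfile N θ).h_pos _).le ?_ _
    rw [waveProfile_h, Real.exp_le_exp]
    linarith [wave_le_two N θ (‖x‖ ^ 2)]
  exact h A

/-- The shell `2 < |x|² < 3`. -/
def shell (m : ℕ) : Set (E m) := {x | 2 < ‖x‖ ^ 2 ∧ ‖x‖ ^ 2 < 3}

theorem isOpen_shell : IsOpen (shell m) :=
  have hn : Continuous fun x : E m ↦ ‖x‖ ^ 2 := by fun_prop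
  (isOpen_lt continuous_const hn).inter (isOpen_lt hn continuous_const)

theorem volume_shell_ne_zero (hm : 1 ≤ m) : volume (shell m) ≠ 0 := by
  refine (isOpen_shell.measure_pos volume ⟨EuclideanSpace.single ⟨0, hm⟩ (3 / 2 : ℝ), ?_⟩).ne'
  constructor <;> simp only [PiLp.norm_single] <;> norm_num

/-- The part of the shell where the derivative of the oscillation is large. -/
def steepSet (m : ℕ) (N θ : ℝ) : Set (E m) :=
  shell m ∩ {x | 1 / 2 ≤ |Real.cos (N * ‖x‖ ^ 2 + θ)|}

theorem measurableSet_steepSet (N θ : ℝ) : MeasurableSet (steepSet m N θ) :=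
  isOpen_shell.measurableSet.inter
    (isClosed_le continuous_const (by fun_prop)).measurableSet

/-- Shifting the phase by `π / 2` turns cosine into sine up to sign, and `sin² + cos² = 1` keeps
both from being below `1 / 2` in absolute value. -/
theorem shell_subset (N : ℝ) : shell m ⊆ steepSet m N 0 ∪ steepSet m N (Real.pi / 2) := by
  intro x hx
  by_cases h : 1 / 2 ≤ |Real.cos (N * ‖x‖ ^ 2 + 0)|
  · exact Or.inl ⟨hx, h⟩
  · refine Or.inr ⟨hx, ?_⟩
    rw [add_zero, not_le] at h
    rw [Set.mem_ofPred_eq, Real.cos_add_pi_div_two, abs_neg]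
    have h1 := Real.sin_sq_add_cos_sq (N * ‖x‖ ^ 2)
    rw [← sq_abs (Real.sin _), ← sq_abs (Real.cos _)] at h1
    nlinarith [abs_nonneg (Real.cos (N * ‖x‖ ^ 2)), abs_nonneg (Real.sin (N * ‖x‖ ^ 2))]

theorem exists_half_volume_shell_le (m : ℕ) (N : ℝ) :
    ∃ θ, volume (shell m) / 2 ≤ volume (steepSet m N θ) := by
  by_contra! h
  have h1 : volume (shell m) ≤ volume (steepSet m N 0) + volume (steepSet m N (Real.pi / 2)) :=
    (measure_mono (shell_subset N)).trans (measure_union_le _ _)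
  have h2 := ENNReal.add_lt_add (h 0) (h (Real.pi / 2))
  rw [ENNReal.add_halves] at h2
  exact absurd h1 (not_le.2 h2)

end CZ

/-! ### Choice of the frequency and conclusion -/

theorem theorem1 (p : ℝ≥0∞) (hp : 1 ≤ p) (m : ℕ) (hm : 2 ≤ m)
    (C₁ C₂ : ℝ) (hC₁ : 0 < C₁) (hC₂ : 0 < C₂) :
    ∃ (g : CZ.Metric m) (σ : ℝ → ℝ) (f : CZ.E m → ℝ),
      g.IsOpenManifold ∧
      ContDiff ℝ ∞ σ ∧ σ 0 = 0 ∧ (∀ r, 0 < r → 0 < σ r) ∧ g.IsWarpedProduct σ ∧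
      ContDiff ℝ ∞ f ∧ HasCompactSupport f ∧
      g.lpPow p (g.hessianNorm f) >
        ENNReal.ofReal C₁ * g.lpPow p (g.laplacian f) + ENNReal.ofReal C₂ * g.lpPow p f := by
  open CZ in
  have hm1 : 1 ≤ m := by omega
  obtain ⟨B, hB⟩ := exists_abs_laplacian_potential_le hm1
  set S : Set (E m) := Metric.closedBall 0 2 with hS
  -- The `max` with `1` makes the bound of `lpPow_le` valid for `p = ∞` as well.
  set V : ℝ≥0∞ := max 1 (ENNReal.ofReal (Real.sqrt (Real.exp 4 ^ (m - 1))) * volume S) with hV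
  have hVtop : V ≠ ⊤ := by
    refine (max_lt ENNReal.one_lt_top (ENNReal.mul_lt_top ENNReal.ofReal_lt_top ?_)).ne
    exact measure_closedBall_lt_top
  let U : ℝ → ℝ≥0∞ := fun b ↦ (if p = ⊤ then ‖b‖ₑ else ‖b‖ₑ ^ p.toReal) * V
  have hU : ∀ b, U b ≠ ⊤ := fun b ↦ by
    refine ENNReal.mul_ne_top ?_ hVtop
    split_ifs
    · exact enorm_ne_top
    · exact ENNReal.rpow_ne_top_of_nonneg ENNReal.toReal_nonneg enorm_ne_top
  set c : ℝ≥0∞ := min 1 (volume (shell m) / 2) with hc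
  have hc0 : c ≠ 0 := by
    refine (lt_min one_pos (ENNReal.half_pos (volume_shell_ne_zero hm1))).ne'
  -- The right-hand side is bounded by a finite quantity fixed before `N` and `θ`, so `n` can be
  -- chosen to beat it.
  obtain ⟨n, hn⟩ := ENNReal.exists_nat_mul_gt hc0
    (ENNReal.add_ne_top.2 ⟨ENNReal.mul_ne_top (ENNReal.ofReal_ne_top (r := C₁)) (hU B),
      ENNReal.mul_ne_top (ENNReal.ofReal_ne_top (r := C₂)) (hU 4)⟩)
  set K : ℝ := n + 1 with hK
  have hK1 : 1 ≤ K := by simp [hK]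
  -- The exponential compensates the factor `exp (-(2 * (m - 1)))` in `le_hessianNorm_potential`,
  -- leaving the Hessian at least `K`.
  set N : ℝ := Real.exp (2 * (m - 1)) * K with hN
  have hN1 : 1 ≤ N := by
    have hm' : (2 : ℝ) ≤ m := by exact_mod_cast hm
    exact one_le_mul_of_one_le_of_one_le (Real.one_le_exp (by linarith)) hK1
  obtain ⟨θ, hθ⟩ := exists_half_volume_shell_le m N
  set g : CZ.Metric m := (waveProfile N θ).metric m with hg
  set f : E m → ℝ := fun y ↦ potential m N θ (‖y‖ ^ 2) with hf
  have hout : ∀ x, x ∉ S → 2 < ‖x‖ := fun x hx ↦ by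
    rwa [hS, mem_closedBall_zero_iff, not_le] at hx
  have hf0 : ∀ x, x ∉ S → f x = 0 := fun x hx ↦
    potential_eq_zero (by nlinarith [hout x hx])
  have hvolS : g.vol S ≤ V := (vol_wave_le hm1 N θ S).trans (le_max_right _ _)
  have hSm : MeasurableSet S := measurableSet_closedBall
  refine ⟨g, fun r ↦ r * Real.exp (wave N θ (r ^ 2)), f, ?_, ?_, by simp, ?_, ?_, ?_, ?_, ?_⟩
  · exact (waveProfile N θ).isOpenManifold two_pos
      (fun s hs ↦ waveProfile_h_eq_one (by linarith)) hm1
  · exact contDiff_id.mul (Real.contDiff_exp.comp ((contDiff_wave N θ).comp (contDiff_id.pow 2)))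
  · exact fun r hr ↦ mul_pos hr (Real.exp_pos _)
  · refine (waveProfile N θ).isWarpedProduct fun r ↦ ?_
    rw [mul_pow, waveProfile_h, ← Real.exp_nat_mul]
    norm_num
  · exact contDiff_comp_norm_sq (contDiff_potential m N θ)
  · exact HasCompactSupport.intro (isCompact_closedBall 0 2) hf0
  · have hΔ : g.lpPow p (g.laplacian f) ≤ U B :=
      g.lpPow_le hp hSm (fun x _ ↦ hB N θ x)
        (fun x hx ↦ laplacian_potential_eq_zero (hout x hx)) (le_max_left _ _) hvolS
    have hfU : g.lpPow p f ≤ U 4 := by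
      refine g.lpPow_le hp hSm (fun x hx ↦ ?_) hf0 (le_max_left _ _) hvolS
      rw [hS, mem_closedBall_zero_iff] at hx
      exact abs_potential_le hm1 (sq_nonneg _) (by nlinarith [norm_nonneg x])
    have hH : ENNReal.ofReal K * c ≤ g.lpPow p (g.hessianNorm f) := by
      refine g.le_lpPow hp (measurableSet_steepSet N θ) hK1 (fun x hx ↦ ?_) hc0 (min_le_left _ _)
        ((min_le_right _ _).trans (hθ.trans (volume_le_vol_wave hm1 N θ _)))
      refine le_trans ?_ (le_abs_self _)
      have := le_hessianNorm_potential hm hN1 hx.1.1 hx.1.2 hx.2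
      rwa [hN, ← mul_assoc, ← Real.exp_add, neg_add_cancel, Real.exp_zero, one_mul, ← hN] at this
    refine lt_of_le_of_lt (add_le_add (mul_le_mul_right hΔ _) (mul_le_mul_right hfU _))
      (hn.trans_le (le_trans ?_ hH))
    refine mul_le_mul_left ?_ c
    rw [← ENNReal.ofReal_natCast]
    exact ENNReal.ofReal_le_ofReal (by simp [hK])
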